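/- Let $G$ be a finite tree on $k\ge 2$ vertices with vertex set $V$, and fix an arbitrary orientation of its edges. Each oriented edge $e=(x,y)$ acts on the words of length $n$ over the alphabet $V$ recursively by $e(xw)=y\,e(w)$, $e(yw)=xw$, and $e(zw)=zw$ for $z\ne x,y$ (and $e(\emptyset)=\emptyset$). For $n\ge 1$, let $\Gamma_n^G$ be the $n$-th Schreier graph of the corresponding tree automaton group: the multigraph (loops and parallel edges allowed) with vertex set $V^n$ that has, for each edge $e$ of $G$ and each $w\in V^n$, exactly one edge, joining $w$ to $e(w)$. Let $T(H,x,y)$ denote the Tutte polynomial of a finite multigraph $H$, defined recursively by $T(H,x,y)=1$ if $H$ has no edges, $T(H,x,y)=x\,T(H\setminus e,x,y)$ if $e$ is a bridge, $T(H,x,y)=y\,T(H\setminus e,x,y)$ if $e$ is a loop, and $T(H,x,y)=T(H\setminus e,x,y)+T(H/e,x,y)$ for any other edge $e$. Then $$ T(\Gamma_n^G,x,y)= y^{(k-1)(k-2)k^{n-1}}\cdot\left(y+x+\cdots+x^{2^n-1}\right)^{k-1}\cdot\prod_{i=1}^{n-1}\left(y+x+\cdots+x^{2^i-1}\right)^{(k-1)(k-2)k^{n-i-1}},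 $$ where $y+x+\cdots+x^{m-1}$ stands for $y+\sum_{j=1}^{m-1}x^j$ (so it is $y+x$ for $m=2$). This holds whatever edges are chosen in the recursion. -/

import Mathlib

/-- A transducer with states `Q` over the alphabet `X`. -/
structure Transducer (Q X : Type*) where
  /-- The restriction map: the state entered after reading a letter. -/
  restriction : Q → X → Q
  /-- The output map. -/
  output : Q → X → X

namespace Transducer

variable {Q X E : Type*}

/-- The action of a state on words of length `n`: the first letter `w 0` is replaced by
`output q (w 0)`, and the state `restriction q (w 0)` acts on the remaining word. -/
def act (A : Transducer Q X) : (n : ℕ) → Q → (Fin n → X) → (Fin n → X)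
  | 0, _, w => w
  | n + 1, q, w =>
    Fin.cons (A.output q (w 0)) (A.act n (A.restriction q (w 0)) (Fin.tail w))

/-- The `n`-th Schreier multigraph of a transducer, for a family `s : E → Q` of generating
states: the vertices are the words of length `n`, and each pair `(e, w)` is one edge,
labelled by `e`, joining `w` to its image under the state `s e`. -/
def schreierGraph (A : Transducer Q X) (s : E → Q) (n : ℕ) :
    Graph (Fin n → X) (E × (Fin n → X)) where
  vertexSet := Set.univ
  edgeSet := Set.univ
  IsLink e u v := s(u, v) = s(e.2, A.act n (s e.1) e.2)
  isLink_symm _ _ := ⟨fun _ _ h => Sym2.eq_swap.trans h⟩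
  eq_or_eq_of_isLink_of_isLink := by
    intro e x y v w h h'
    have h2 := h.trans h'.symm
    rw [Sym2.eq_iff] at h2
    rcases h2 with h2 | h2
    · exact Or.inl h2.1
    · exact Or.inr h2.1
  edge_mem_iff_exists_isLink e := ⟨fun _ => ⟨_, _, rfl⟩, fun _ => Set.mem_univ _⟩
  left_mem_of_isLink _ _ _ _ := Set.mem_univ _

end Transducer

namespace SimpleGraph

variable {V : Type*}

/-- A choice of an orientation of every edge of `G`; `o.arc e = (x, y)` means that the edge `e`
is oriented from `x` to `y`. -/
structure EdgeOrientation (G : SimpleGraph V) where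
  /-- The ordered pair chosen for an edge. -/
  arc : G.edgeSet → V × V
  /-- The chosen pair consists of the two ends of the edge. -/
  mk_arc : ∀ e : G.edgeSet, s((arc e).1, (arc e).2) = (e : Sym2 V)

variable [DecidableEq V] {G : SimpleGraph V}

/-- The graph automaton of an oriented graph. Its states are the oriented edges `some e` and
the sink `none`. An oriented edge `e = (x, y)` exchanges the letters `x` and `y` and fixes all
others; its restriction is `e` itself at the letter `x` and the sink at every other letter. -/
def graphAutomaton (o : G.EdgeOrientation) : Transducer (Option G.edgeSet) V where
  restriction q z :=
    match q with
    | none => none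
    | some e => if z = (o.arc e).1 then some e else none
  output q z :=
    match q with
    | none => z
    | some e =>
      if z = (o.arc e).1 then (o.arc e).2 else if z = (o.arc e).2 then (o.arc e).1 else z

/-- The `n`-th Schreier graph of the graph automaton of `G`, with respect to the generators given
by the oriented edges of `G` (the sink acts trivially and contributes no edges). -/
def automatonSchreierGraph (o : G.EdgeOrientation) (n : ℕ) :
    Graph (Fin n → V) (G.edgeSet × (Fin n → V)) :=
  (graphAutomaton o).schreierGraph some n

end SimpleGraph

namespace Graph

variable {α β : Type*}

/-- An edge is a bridge if its ends are not connected by a path once it is deleted. -/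
def IsBridge (G : Graph α β) (e : β) : Prop :=
  ∃ x y, G.IsLink e x y ∧ ¬ Relation.ReflTransGen (G.deleteEdges {e}).Adj x y

open Classical in
/-- The contraction of an edge `e` with ends `x` and `y`: delete `e` and identify `y` with `x`. -/
noncomputable def contractEdge (G : Graph α β) (e : β) (x y : α) : Graph α β :=
  (G.deleteEdges {e}).map (fun v => if v = y then x else v)

/-- `G.IsTuttePolynomial p`: the polynomial `p` (with `X 0` for `x` and `X 1` for `y`) is obtained
from the multigraph `G` by the deletion-contraction recursion of the Tutte polynomial, with the
edges treated in some order. -/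
inductive IsTuttePolynomial : Graph α β → MvPolynomial (Fin 2) ℤ → Prop
  | edgeless (G : Graph α β) : G.edgeSet = ∅ → IsTuttePolynomial G 1
  | bridge (G : Graph α β) (e : β) (p : MvPolynomial (Fin 2) ℤ) :
      G.IsBridge e → IsTuttePolynomial (G.deleteEdges {e}) p →
      IsTuttePolynomial G (MvPolynomial.X 0 * p)
  | loop (G : Graph α β) (e : β) (x : α) (p : MvPolynomial (Fin 2) ℤ) :
      G.IsLoopAt e x → IsTuttePolynomial (G.deleteEdges {e}) p →
      IsTuttePolynomial G (MvPolynomial.X 1 * p)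
  | ordinary (G : Graph α β) (e : β) (x y : α) (p q : MvPolynomial (Fin 2) ℤ) :
      G.IsLink e x y → x ≠ y → ¬ G.IsBridge e →
      IsTuttePolynomial (G.deleteEdges {e}) p → IsTuttePolynomial (G.contractEdge e x y) q →
      IsTuttePolynomial G (p + q)

end Graph

/-- The polynomial `y + x + x ^ 2 + ⋯ + x ^ (m - 1)`, with `X 0` for `x` and `X 1` for `y`. -/
noncomputable def cyclePolynomial (m : ℕ) : MvPolynomial (Fin 2) ℤ :=
  MvPolynomial.X 1 + ∑ j ∈ Finset.Ico 1 m, MvPolynomial.X 0 ^ j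

/-!
An oriented edge `e = (a, b)` acts on a word as a binary odometer with digits `a` and `b` on the
longest prefix over `{a, b}`, so each of its orbits is a cycle whose length is a power of two.
Since deleting `e` separates `a` from `b` in the tree, there is for each orbit of `e` a map of the
vertices of the Schreier graph that fixes this orbit and contracts all other edges. Hence the cycle
matroid of the Schreier graph is the direct sum of the circuits given by the orbits, its Tutte
polynomial is the product of those of the circuits, and the circuit with `m` edges has the Tutte
polynomial `y + x + ⋯ + x ^ (m - 1)`. It remains to count the orbits of each length `2 ^ i`.
-/

namespace TreeAutomaton

open MvPolynomial

section Joined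

variable {α α' β : Type*} {G : Graph α β} {A B : Set β} {u v x y : α} {e f : β}

/-- Two vertices are joined through a set `A` of edges if they are in the same component of the
spanning subgraph with edge set `A`. -/
def Joined (G : Graph α β) (A : Set β) : α → α → Prop :=
  Relation.ReflTransGen (G.restrict A).Adj

lemma joined_of_isLink (h : G.IsLink e u v) (he : e ∈ A) : Joined G A u v :=
  .single ⟨e, he, h⟩

lemma Joined.symm (h : Joined G A u v) : Joined G A v u :=
  haveI : Std.Symm (G.restrict A).Adj := ⟨fun _ _ => .symm⟩
  Relation.ReflTransGen.stdSymm.symm _ _ h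

lemma Joined.mono (hAB : A ⊆ B) (h : Joined G A u v) : Joined G B u v :=
  Relation.ReflTransGen.mono (fun _ _ ⟨e, he, hl⟩ => ⟨e, hAB he, hl⟩) _ _ h

lemma Joined.mem_iff {P : Set α} (hP : ∀ e ∈ A, ∀ x y, G.IsLink e x y → (x ∈ P ↔ y ∈ P))
    (h : Joined G A u v) : u ∈ P ↔ v ∈ P := by
  induction h with
  | refl => rfl
  | tail _ hadj ih =>
    obtain ⟨e, he, hl⟩ := hadj
    exact ih.trans (hP e he _ _ hl)

lemma joined_empty_iff : Joined G ∅ u v ↔ u = v :=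
  ⟨fun h => ((h.mem_iff (P := {u}) fun _ he => he.elim).1 rfl).symm, fun h => h ▸ .refl⟩

lemma restrict_deleteEdges (hA : Disjoint A B) : (G.deleteEdges B).restrict A = G.restrict A := by
  have hinter : (G.edgeSet \ B) ∩ A = G.edgeSet ∩ A := by
    rw [Set.sdiff_inter_right_comm, (hA.inter_left' _).sdiff_eq_left]
  rw [← G.restrict_edgeSet_sdiff_eq_deleteEdges, Graph.restrict_restrict, hinter,
    Graph.restrict_edgeSet_inter]

lemma joined_map_iff {φ : α → α'} (hφ : ∀ u v, φ u = φ v ↔ Joined G B u v) :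
    Joined (G.map φ) A (φ u) (φ v) ↔ Joined G (B ∪ A) u v := by
  constructor
  · intro h
    suffices ∀ q, Joined (G.map φ) A (φ u) q → ∀ w, φ w = q → Joined G (B ∪ A) u w from
      this _ h v rfl
    intro q hq
    induction hq with
    | refl => exact fun w hw => ((hφ _ _).1 hw.symm).mono Set.subset_union_left
    | tail _ hadj ih =>
      rintro w rfl
      obtain ⟨e, he, s, t, hst, rfl, htw⟩ := hadj
      exact ((ih s rfl).trans (joined_of_isLink hst (Or.inr he))).trans
        (((hφ _ _).1 htw).mono Set.subset_union_left)
  · intro h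
    induction h with
    | refl => exact .refl
    | tail _ hadj ih =>
      obtain ⟨e, he | he, hst⟩ := hadj
      · rwa [← (hφ _ _).2 (joined_of_isLink hst he)]
      · exact ih.trans (joined_of_isLink (hst.map φ) he)

/-- An edge is spanned by a set `A` of edges if its ends are joined through `A`; for `e ∉ A` this
says that `e` is in the closure of `A` in the cycle matroid of the graph. -/
def Spans (G : Graph α β) (A : Set β) (e : β) : Prop :=
  ∃ x y, G.IsLink e x y ∧ Joined G A x y

lemma spans_iff_joined (h : G.IsLink e x y) : Spans G A e ↔ Joined G A x y := by
  refine ⟨?_, fun h' => ⟨x, y, h, h'⟩⟩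
  rintro ⟨u, v, huv, hj⟩
  rcases huv.eq_and_eq_or_eq_and_eq h with ⟨rfl, rfl⟩ | ⟨rfl, rfl⟩
  · exact hj
  · exact hj.symm

lemma isBridge_iff_not_spans (he : e ∈ G.edgeSet) :
    G.IsBridge e ↔ ¬ Spans G (G.edgeSet \ {e}) e := by
  obtain ⟨x, y, hxy⟩ := Graph.exists_isLink_of_mem_edgeSet he
  simp only [Graph.IsBridge, ← G.restrict_edgeSet_sdiff_eq_deleteEdges]
  refine ⟨?_, fun hs => ⟨x, y, hxy, fun h => hs ⟨x, y, hxy, h⟩⟩⟩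
  rintro ⟨u, v, huv, hn⟩ hs
  exact hn ((spans_iff_joined huv).1 hs)

lemma spans_deleteEdges_iff (hA : Disjoint A B) (he : e ∉ B) :
    Spans (G.deleteEdges B) A e ↔ Spans G A e := by
  simp only [Spans, Joined, restrict_deleteEdges hA, Graph.deleteEdges_isLink, he,
    not_false_eq_true, and_true]

open Classical in
lemma ite_eq_ite_iff_joined (hf : G.IsLink f x y) :
    ((if u = y then x else u) = if v = y then x else v) ↔ Joined G {f} u v := by
  have hxy : Joined G {f} x y := joined_of_isLink hf rfl
  constructor
  · intro h
    split_ifs at h with hu hv hv <;> subst_vars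
    exacts [.refl, hxy.symm, hxy, .refl]
  · intro h
    refine (h.mem_iff (P := {w | _ = if w = y then x else w}) ?_).1 rfl
    rintro _ rfl s t hst
    rcases hst.eq_and_eq_or_eq_and_eq hf with ⟨rfl, rfl⟩ | ⟨rfl, rfl⟩ <;>
      simp only [Set.mem_ofPred_eq, if_true, ite_self]

lemma spans_contractEdge_iff (hf : G.IsLink f x y) (hfA : f ∉ A) (hef : e ≠ f) :
    Spans (G.contractEdge f x y) A e ↔ Spans G (insert f A) e := by
  have hcomm : ∀ φ : α → α, (G.deleteEdges {f}).map φ = (G.map φ).deleteEdges {f} := fun φ =>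
    Graph.ext rfl fun g s t => by
      simp only [Graph.map_isLink, Graph.deleteEdges_isLink, Relation.Map]
      tauto
  rw [Graph.contractEdge, hcomm, spans_deleteEdges_iff (Set.disjoint_singleton_right.2 hfA) hef]
  by_cases he : e ∈ G.edgeSet
  · obtain ⟨u, v, huv⟩ := Graph.exists_isLink_of_mem_edgeSet he
    rw [spans_iff_joined (huv.map _), spans_iff_joined huv,
      joined_map_iff fun _ _ => ite_eq_ite_iff_joined hf, Set.singleton_union]
  · exact iff_of_false (fun ⟨_, _, h, _⟩ => he h.edge_mem) fun ⟨_, _, h, _⟩ => he h.edge_mem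

end Joined

section CircuitSum

variable {α β ι : Type*} {G H : Graph α β} {c : β → ι} {S : Set ι} {e : β} {x y : α}

/-- The cycle matroid of `G` is the direct sum of the colour classes of its edges, where a class is
a circuit if its colour is in `S` and otherwise consists of bridges. The condition `exists_edge`
excludes empty circuits. -/
structure IsCircuitSum (G : Graph α β) (c : β → ι) (S : Set ι) : Prop where
  exists_edge : ∀ i ∈ S, ∃ e ∈ G.edgeSet, c e = i
  spans_iff : ∀ e ∈ G.edgeSet, ∀ A ⊆ G.edgeSet \ {e},
    (Spans G A e ↔ c e ∈ S ∧ ∀ f ∈ G.edgeSet, f ≠ e → c f = c e → f ∈ A)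

lemma IsCircuitSum.isBridge_iff (h : IsCircuitSum G c S) (he : e ∈ G.edgeSet) :
    G.IsBridge e ↔ c e ∉ S := by
  rw [isBridge_iff_not_spans he, h.spans_iff e he _ subset_rfl]
  exact not_congr ⟨And.left, fun hS => ⟨hS, fun f hf hne _ => ⟨hf, hne⟩⟩⟩

lemma IsCircuitSum.eq_iff (h : IsCircuitSum G c S) (hl : G.IsLink e x y) :
    x = y ↔ c e ∈ S ∧ ∀ f ∈ G.edgeSet, c f = c e → f = e := by
  rw [← joined_empty_iff (G := G), ← spans_iff_joined hl,
    h.spans_iff e hl.edge_mem ∅ (Set.empty_subset _)]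
  simp only [Set.mem_empty_iff_false, imp_false, ne_eq, not_imp_not]

lemma IsCircuitSum.deleteEdges (h : IsCircuitSum G c S) (he : e ∈ G.edgeSet) :
    IsCircuitSum (G.deleteEdges {e}) c (S \ {c e}) where
  exists_edge := by
    rintro i ⟨hi, hne⟩
    obtain ⟨f, hf, rfl⟩ := h.exists_edge i hi
    exact ⟨f, ⟨hf, fun hfe => hne (congrArg c hfe)⟩, rfl⟩
  spans_iff := by
    rintro g ⟨hg, hge : g ≠ e⟩ A hA
    have heA : e ∉ A := fun he => (hA he).1.2 rfl
    rw [spans_deleteEdges_iff (Set.disjoint_singleton_right.2 heA) hge,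
      h.spans_iff g hg A fun f hf => ⟨(hA hf).1.1, (hA hf).2⟩]
    constructor
    · rintro ⟨hS, hall⟩
      exact ⟨⟨hS, fun hc => heA (hall e he hge.symm (Eq.symm hc))⟩, fun f hf => hall f hf.1⟩
    · rintro ⟨⟨hS, hc⟩, hall⟩
      refine ⟨hS, fun f hf hne hfg => hall f ⟨hf, ?_⟩ hne hfg⟩
      rintro rfl
      exact hc hfg.symm

lemma IsCircuitSum.contractEdge (h : IsCircuitSum G c S) (hl : G.IsLink e x y) (hne : x ≠ y) :
    IsCircuitSum (G.contractEdge e x y) c S where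
  exists_edge := by
    intro i hi
    obtain ⟨f, hf, rfl⟩ := h.exists_edge i hi
    by_cases hc : c f = c e
    · have hnot : ¬ ∀ g ∈ G.edgeSet, c g = c e → g = e := fun hall =>
        hne ((h.eq_iff hl).2 ⟨hc ▸ hi, hall⟩)
      push Not at hnot
      obtain ⟨g, hg, hge, hne⟩ := hnot
      exact ⟨g, ⟨hg, hne⟩, hge.trans hc.symm⟩
    · exact ⟨f, ⟨hf, fun hfe => hc (congrArg c hfe)⟩, rfl⟩
  spans_iff := by
    rintro g ⟨hg, hge : g ≠ e⟩ A hA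
    have heA : e ∉ A := fun he => (hA he).1.2 rfl
    have hinsert : insert e A ⊆ G.edgeSet \ {g} :=
      Set.insert_subset ⟨hl.edge_mem, hge.symm⟩ fun f hf => ⟨(hA hf).1.1, (hA hf).2⟩
    rw [spans_contractEdge_iff hl heA hge, h.spans_iff g hg _ hinsert]
    refine and_congr_right fun _ => ⟨fun hall f hf hfg hc => ?_, fun hall f hf hfg hc => ?_⟩
    · exact (hall f hf.1 hfg hc).resolve_left hf.2
    · exact or_iff_not_imp_left.2 fun hfe => hall f ⟨hf, hfe⟩ hfg hc

lemma cyclePolynomial_one : cyclePolynomial 1 = X 1 := by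
  simp [cyclePolynomial]

lemma cyclePolynomial_succ {m : ℕ} (hm : 1 ≤ m) :
    cyclePolynomial (m + 1) = cyclePolynomial m + X 0 ^ m := by
  rw [cyclePolynomial, cyclePolynomial, Finset.sum_Ico_succ_top hm, add_assoc]

/-- The edges of `G` of colour `i`. -/
def colourClass (G : Graph α β) (c : β → ι) (i : ι) : Set β :=
  G.edgeSet ∩ c ⁻¹' {i}

open Classical in
/-- The Tutte polynomial of `m` edges that form a circuit if `i ∈ S`, and of `m` bridges
otherwise. -/
noncomputable def classPolynomial (S : Set ι) (i : ι) (m : ℕ) : MvPolynomial (Fin 2) ℤ :=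
  if i ∈ S then cyclePolynomial m else X 0 ^ m

/-- The Tutte polynomial of a graph `G` with `IsCircuitSum G c S`, as a product over the colour
classes. -/
noncomputable def circuitSumPolynomial [Fintype ι] (G : Graph α β) (c : β → ι) (S : Set ι) :
    MvPolynomial (Fin 2) ℤ :=
  ∏ i, classPolynomial S i (colourClass G c i).ncard

lemma colourClass_eq_sdiff (hH : H.edgeSet = G.edgeSet \ {e}) (i : ι) :
    colourClass H c i = colourClass G c i \ {e} := by
  rw [colourClass, hH, Set.sdiff_inter_right_comm, colourClass]

lemma circuitSumPolynomial_eq_mul_prod_erase [Fintype ι] [DecidableEq ι]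
    (hH : H.edgeSet = G.edgeSet \ {e}) (he : e ∈ G.edgeSet) {m : ℕ}
    (hm : (colourClass G c (c e)).ncard = m + 1) {T : Set ι} (hT : ∀ i ≠ c e, i ∈ T ↔ i ∈ S) :
    circuitSumPolynomial H c T = classPolynomial T (c e) m *
      ∏ i ∈ Finset.univ.erase (c e), classPolynomial S i (colourClass G c i).ncard := by
  have hmem : e ∈ colourClass G c (c e) := ⟨he, rfl⟩
  rw [circuitSumPolynomial, ← Finset.mul_prod_erase _ _ (Finset.mem_univ (c e)),
    colourClass_eq_sdiff hH, Set.ncard_sdiff_singleton_of_mem hmem, hm, Nat.add_sub_cancel]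
  refine congrArg _ (Finset.prod_congr rfl fun i hi => ?_)
  have hne : i ≠ c e := Finset.ne_of_mem_erase hi
  have heG : e ∉ colourClass G c i := fun hei => hne hei.2.symm
  rw [colourClass_eq_sdiff hH, Set.sdiff_singleton_eq_self heG, classPolynomial, classPolynomial,
    hT i hne]

lemma exists_ncard_colourClass_eq_succ (hfin : G.edgeSet.Finite) (he : e ∈ G.edgeSet) :
    ∃ m, (colourClass G c (c e)).ncard = m + 1 :=
  Nat.exists_eq_succ_of_ne_zero
    (Set.ncard_ne_zero_of_mem ⟨he, rfl⟩ (hfin.subset Set.inter_subset_left))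

lemma IsCircuitSum.eq_iff_ncard_colourClass (h : IsCircuitSum G c S) (hl : G.IsLink e x y)
    (hS : c e ∈ S) : x = y ↔ (colourClass G c (c e)).ncard = 1 := by
  rw [h.eq_iff hl, Set.ncard_eq_one]
  constructor
  · rintro ⟨-, hall⟩
    exact ⟨e, Set.eq_singleton_iff_unique_mem.2 ⟨⟨hl.edge_mem, rfl⟩, fun f hf => hall f hf.1 hf.2⟩⟩
  · rintro ⟨g, hg⟩
    exact ⟨hS, fun f hf hc => Set.subsingleton_of_subset_singleton hg.subset ⟨hf, hc⟩
      ⟨hl.edge_mem, rfl⟩⟩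

section Recursion

variable [Fintype ι]

lemma IsCircuitSum.circuitSumPolynomial_eq_one (h : IsCircuitSum G c S) (hG : G.edgeSet = ∅) :
    circuitSumPolynomial G c S = 1 := by
  refine Finset.prod_eq_one fun i _ => ?_
  have hi : i ∉ S := fun hi => by
    obtain ⟨e, he, -⟩ := h.exists_edge i hi
    exact hG.subset he
  rw [classPolynomial, if_neg hi, colourClass, hG, Set.empty_inter, Set.ncard_empty, pow_zero]

lemma IsCircuitSum.circuitSumPolynomial_of_isBridge (h : IsCircuitSum G c S)
    (hfin : G.edgeSet.Finite) (he : e ∈ G.edgeSet) (hb : G.IsBridge e) :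
    circuitSumPolynomial G c S =
      X 0 * circuitSumPolynomial (G.deleteEdges {e}) c (S \ {c e}) := by
  classical
  obtain ⟨m, hm⟩ := exists_ncard_colourClass_eq_succ (c := c) hfin he
  rw [circuitSumPolynomial_eq_mul_prod_erase (H := G.deleteEdges {e}) rfl he hm
      (S := S) (by simp +contextual),
    circuitSumPolynomial, ← Finset.mul_prod_erase _ _ (Finset.mem_univ (c e)), hm,
    classPolynomial, classPolynomial, if_neg ((h.isBridge_iff he).1 hb),
    if_neg (fun hc => hc.2 rfl)]
  ring

lemma IsCircuitSum.circuitSumPolynomial_of_isLoopAt (h : IsCircuitSum G c S)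
    (hl : G.IsLoopAt e x) :
    circuitSumPolynomial G c S =
      X 1 * circuitSumPolynomial (G.deleteEdges {e}) c (S \ {c e}) := by
  classical
  have hS : c e ∈ S := ((h.eq_iff hl).1 rfl).1
  have hcard : (colourClass G c (c e)).ncard = 1 := (h.eq_iff_ncard_colourClass hl hS).1 rfl
  rw [circuitSumPolynomial_eq_mul_prod_erase (H := G.deleteEdges {e}) rfl hl.edge_mem hcard
      (S := S) (by simp +contextual),
    circuitSumPolynomial, ← Finset.mul_prod_erase _ _ (Finset.mem_univ (c e)), hcard,
    classPolynomial, classPolynomial, if_pos hS, if_neg (fun hc => hc.2 rfl), cyclePolynomial_one,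
    pow_zero, one_mul]

lemma IsCircuitSum.circuitSumPolynomial_of_ordinary (h : IsCircuitSum G c S)
    (hfin : G.edgeSet.Finite) (hl : G.IsLink e x y) (hne : x ≠ y) (hb : ¬ G.IsBridge e) :
    circuitSumPolynomial G c S = circuitSumPolynomial (G.deleteEdges {e}) c (S \ {c e}) +
      circuitSumPolynomial (G.contractEdge e x y) c S := by
  classical
  obtain ⟨m, hm⟩ := exists_ncard_colourClass_eq_succ (c := c) hfin hl.edge_mem
  have hS : c e ∈ S := not_not.1 (mt (h.isBridge_iff hl.edge_mem).2 hb)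
  have hm1 : 1 ≤ m := Nat.one_le_iff_ne_zero.2 fun hm0 =>
    hne ((h.eq_iff_ncard_colourClass hl hS).2 (by rw [hm, hm0]))
  rw [circuitSumPolynomial_eq_mul_prod_erase (H := G.deleteEdges {e}) rfl hl.edge_mem hm
      (S := S) (by simp +contextual),
    circuitSumPolynomial_eq_mul_prod_erase (H := G.contractEdge e x y) rfl hl.edge_mem hm
      fun _ _ => Iff.rfl,
    circuitSumPolynomial, ← Finset.mul_prod_erase _ _ (Finset.mem_univ (c e)), hm,
    classPolynomial, classPolynomial, classPolynomial, if_pos hS, if_pos hS,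
    if_neg (fun hc => hc.2 rfl), cyclePolynomial_succ hm1]
  ring

lemma IsCircuitSum.isTuttePolynomial (h : IsCircuitSum G c S) (hfin : G.edgeSet.Finite) :
    G.IsTuttePolynomial (circuitSumPolynomial G c S) := by
  induction hm : G.edgeSet.ncard generalizing G S with
  | zero =>
    have hG : G.edgeSet = ∅ := (Set.ncard_eq_zero hfin).1 hm
    exact h.circuitSumPolynomial_eq_one hG ▸ .edgeless G hG
  | succ m ih =>
    obtain ⟨e, he⟩ : G.edgeSet.Nonempty := Set.nonempty_of_ncard_ne_zero (by omega)
    obtain ⟨x, y, hl⟩ := Graph.exists_isLink_of_mem_edgeSet he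
    have hcard : (G.edgeSet \ {e}).ncard = m := by
      rw [Set.ncard_sdiff_singleton_of_mem he, hm, Nat.add_sub_cancel]
    have hdel := ih (h.deleteEdges he) (hfin.subset Set.sdiff_subset) hcard
    by_cases hb : G.IsBridge e
    · rw [h.circuitSumPolynomial_of_isBridge hfin he hb]
      exact .bridge G e _ hb hdel
    obtain rfl | hne := eq_or_ne x y
    · rw [h.circuitSumPolynomial_of_isLoopAt hl]
      exact .loop G e x _ hl hdel
    · rw [h.circuitSumPolynomial_of_ordinary hfin hl hne hb]
      exact .ordinary G e x y _ _ hl hne hb hdel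
        (ih (h.contractEdge hl hne) (hfin.subset Set.sdiff_subset) hcard)

lemma IsCircuitSum.eq_circuitSumPolynomial (h : IsCircuitSum G c S) (hfin : G.edgeSet.Finite)
    {p : MvPolynomial (Fin 2) ℤ} (hp : G.IsTuttePolynomial p) :
    p = circuitSumPolynomial G c S := by
  induction hp generalizing S with
  | edgeless G hG => exact (h.circuitSumPolynomial_eq_one hG).symm
  | bridge G e p hb _ ih =>
    obtain ⟨x, y, hl, -⟩ := id hb
    rw [h.circuitSumPolynomial_of_isBridge hfin hl.edge_mem hb,
      ih (h.deleteEdges hl.edge_mem) (hfin.subset Set.sdiff_subset)]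
  | loop G e x p hl _ ih =>
    rw [h.circuitSumPolynomial_of_isLoopAt hl,
      ih (h.deleteEdges hl.edge_mem) (hfin.subset Set.sdiff_subset)]
  | ordinary G e x y p q hl hne hb _ _ ihp ihq =>
    rw [h.circuitSumPolynomial_of_ordinary hfin hl hne hb,
      ihp (h.deleteEdges hl.edge_mem) (hfin.subset Set.sdiff_subset),
      ihq (h.contractEdge hl hne) (hfin.subset Set.sdiff_subset)]

theorem IsCircuitSum.isTuttePolynomial_iff (h : IsCircuitSum G c S) (hfin : G.edgeSet.Finite)
    {p : MvPolynomial (Fin 2) ℤ} : G.IsTuttePolynomial p ↔ p = circuitSumPolynomial G c S :=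
  ⟨h.eq_circuitSumPolynomial hfin, fun hp => hp ▸ h.isTuttePolynomial hfin⟩

end Recursion

end CircuitSum

section OrbitMap

variable {X Y : Type*} {f : X → X} {r : X → Y} {x y : X}

/-- The map `r` is the quotient map onto the orbits of `f`, where moreover any point of an orbit
can be reached from any other by iterating `f`; on a finite orbit this means that `f` permutes the
orbit cyclically. -/
structure IsOrbitMap (f : X → X) (r : X → Y) : Prop where
  surjective : Function.Surjective r
  apply_eq : ∀ x, r (f x) = r x
  exists_iterate_eq : ∀ {x y}, r x = r y → ∃ j, f^[j] x = y

lemma IsOrbitMap.exists_iterate_apply_eq (h : IsOrbitMap f r) (x : X) : ∃ j, f^[j] (f x) = x :=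
  h.exists_iterate_eq (h.apply_eq x)

lemma IsOrbitMap.iterate_eq (h : IsOrbitMap f r) (j : ℕ) (x : X) : r (f^[j] x) = r x := by
  induction j with
  | zero => rfl
  | succ j ih => rw [Function.iterate_succ_apply', h.apply_eq, ih]

lemma IsOrbitMap.injective (h : IsOrbitMap f r) : Function.Injective f := by
  intro x y hxy
  obtain ⟨i, hi⟩ := h.exists_iterate_apply_eq x
  obtain ⟨j, hj⟩ := h.exists_iterate_apply_eq y
  have hx : Function.IsPeriodicPt f (i + 1) x := hi
  have hy : Function.IsPeriodicPt f (j + 1) y := hj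
  exact hx.eq_of_apply_eq hy i.succ_pos j.succ_pos hxy

/-- Removing the steps out of `x` and out of `y` cuts the cycle of `f` through `x` and `y` into two
arcs. -/
lemma IsOrbitMap.exists_arc (h : IsOrbitMap f r) (hne : x ≠ y) (hr : r x = r y) :
    ∃ I : Set X, f x ∈ I ∧ x ∉ I ∧ ∀ v, v ≠ x → v ≠ y → (f v ∈ I ↔ v ∈ I) := by
  classical
  have hex : ∃ j, f^[j] x = y := h.exists_iterate_eq hr
  set j := Nat.find hex
  have hj : f^[j] x = y := Nat.find_spec hex
  have hmin : ∀ i < j, f^[i] x ≠ y := fun i hi => Nat.find_min hex hi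
  have hj0 : 0 < j := Nat.pos_of_ne_zero fun hj0 => hne (by rwa [hj0] at hj)
  refine ⟨{v | ∃ i, i < j ∧ f^[i + 1] x = v}, ⟨0, hj0, rfl⟩, ?_, fun v hvx hvy => ⟨?_, ?_⟩⟩
  · rintro ⟨i, hi, hix⟩
    refine hmin (j - (i + 1)) (by omega) ?_
    rw [← hj]
    nth_rw 2 [← Nat.sub_add_cancel (Nat.succ_le_of_lt hi)]
    rw [Function.iterate_add_apply, hix]
  · rintro ⟨i, hi, hiv⟩
    rw [Function.iterate_succ_apply'] at hiv
    obtain rfl := h.injective hiv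
    cases i with
    | zero => exact absurd rfl hvx
    | succ i => exact ⟨i, by omega, rfl⟩
  · rintro ⟨i, hi, rfl⟩
    have hij : i + 1 ≠ j := fun hij => hvy (hij ▸ hj)
    exact ⟨i + 1, by omega, Function.iterate_succ_apply' _ _ _⟩

end OrbitMap

section OrbitColour

variable {X E : Type*} {O : E → Type*} {f : E → X → X} {r : ∀ e, X → O e}
  {G : Graph X (E × X)} {A : Set (E × X)} {e : E} {x y : X}

/-- The colour of an edge of the Schreier graph of the maps `f e`, which joins `x` to `f e x`: the
orbit of `f e` in which it lies. -/
def orbitColour (r : ∀ e, X → O e) (p : E × X) : Σ e, O e :=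
  ⟨p.1, r p.1 p.2⟩

lemma orbitColour_eq_iff {p : E × X} : orbitColour r p = orbitColour r (e, x) ↔
    ∃ y, p = (e, y) ∧ r e y = r e x := by
  obtain ⟨d, y⟩ := p
  constructor
  · intro h
    obtain rfl : d = e := congrArg Sigma.fst h
    exact ⟨y, rfl, eq_of_heq (Sigma.mk.inj h).2⟩
  · rintro ⟨y, ⟨⟩, h⟩
    exact congrArg (Sigma.mk e) h

/-- A map `φ` of the vertices of the Schreier graph of the maps `f d` that fixes the orbit `q` of
`f e` pointwise and contracts all edges outside of this orbit. -/
structure IsOrbitRetraction (f : E → X → X) (r : ∀ e, X → O e) (e : E) (q : O e) (φ : X → X) :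
    Prop where
  apply_of_mem : ∀ x, r e x = q → φ x = x
  apply_eq_of_ne : ∀ d ≠ e, ∀ x, φ (f d x) = φ x
  apply_eq_of_notMem : ∀ x, r e x ≠ q → φ (f e x) = φ x

lemma joined_of_forall_orbit_mem (hf : IsOrbitMap (f e) (r e))
    (hlink : ∀ p : E × X, G.IsLink p p.2 (f p.1 p.2))
    (hA : ∀ y ≠ x, r e y = r e x → (e, y) ∈ A) : Joined G A x (f e x) := by
  classical
  have hex := hf.exists_iterate_apply_eq x
  have hwalk : ∀ i ≤ Nat.find hex, Joined G A (f e x) ((f e)^[i] (f e x)) := by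
    intro i
    induction i with
    | zero => exact fun _ => .refl
    | succ i ih =>
      intro hi
      rw [Function.iterate_succ_apply']
      exact (ih (by omega)).trans (joined_of_isLink (hlink (e, _))
        (hA _ (Nat.find_min hex hi) ((hf.iterate_eq i _).trans (hf.apply_eq x))))
  have hback := hwalk _ le_rfl
  rw [Nat.find_spec hex] at hback
  exact hback.symm

lemma not_joined_of_orbit_notMem (hf : IsOrbitMap (f e) (r e))
    (hlink : ∀ p : E × X, G.IsLink p p.2 (f p.1 p.2)) {φ : X → X}
    (hφ : IsOrbitRetraction f r e (r e x) φ) (hxA : (e, x) ∉ A) (hne : x ≠ y)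
    (hr : r e x = r e y) (hyA : (e, y) ∉ A) : ¬ Joined G A x (f e x) := by
  intro hj
  obtain ⟨I, hfx, hx, hI⟩ := hf.exists_arc hne hr
  -- No edge of `A` leaves the preimage of `I`: it is contracted by `φ`, or it is an edge of the
  -- orbit and not one of the two that separate `I` from its complement.
  have hstep : ∀ p ∈ A, (p.2 ∈ φ ⁻¹' I ↔ f p.1 p.2 ∈ φ ⁻¹' I) := by
    rintro ⟨d, v⟩ hA
    by_cases hd : d = e
    · subst hd
      by_cases hv : r d v = r d x
      · rw [Set.mem_preimage, Set.mem_preimage, hφ.apply_of_mem v hv,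
          hφ.apply_of_mem _ ((hf.apply_eq v).trans hv)]
        exact (hI v (fun h => hxA (h ▸ hA)) fun h => hyA (h ▸ hA)).symm
      · rw [Set.mem_preimage, Set.mem_preimage, hφ.apply_eq_of_notMem v hv]
    · rw [Set.mem_preimage, Set.mem_preimage, hφ.apply_eq_of_ne d hd]
  have hmem : x ∈ φ ⁻¹' I ↔ f e x ∈ φ ⁻¹' I := hj.mem_iff fun p hp u v hl => by
    rcases hl.eq_and_eq_or_eq_and_eq (hlink p) with ⟨rfl, rfl⟩ | ⟨rfl, rfl⟩
    exacts [hstep p hp, (hstep p hp).symm]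
  rw [Set.mem_preimage, Set.mem_preimage, hφ.apply_of_mem x rfl,
    hφ.apply_of_mem _ (hf.apply_eq x)] at hmem
  exact hx (hmem.2 hfx)

theorem isCircuitSum_orbitColour (hf : ∀ e, IsOrbitMap (f e) (r e))
    (hlink : ∀ p : E × X, G.IsLink p p.2 (f p.1 p.2))
    (hφ : ∀ e q, ∃ φ, IsOrbitRetraction f r e q φ) :
    IsCircuitSum G (orbitColour r) Set.univ where
  exists_edge := by
    rintro ⟨e, q⟩ -
    obtain ⟨x, rfl⟩ := (hf e).surjective q
    exact ⟨(e, x), (hlink _).edge_mem, rfl⟩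
  spans_iff := by
    rintro ⟨e, x⟩ - A hA
    have hxA : (e, x) ∉ A := fun h => (hA h).2 rfl
    rw [spans_iff_joined (hlink (e, x))]
    constructor
    · refine fun hj => ⟨Set.mem_univ _, fun p _ hne hc => ?_⟩
      obtain ⟨y, rfl, hr⟩ := orbitColour_eq_iff.1 hc
      obtain ⟨φ, hφ⟩ := hφ e (r e x)
      by_contra hyA
      exact not_joined_of_orbit_notMem (hf e) hlink hφ hxA (fun h => hne (h ▸ rfl)) hr.symm hyA hj
    · rintro ⟨-, hall⟩
      exact joined_of_forall_orbit_mem (hf e) hlink fun y hne hr =>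
        hall (e, y) (hlink _).edge_mem (fun h => hne (congrArg Prod.snd h))
          (orbitColour_eq_iff.2 ⟨y, rfl, hr⟩)

lemma ncard_colourClass_orbitColour (hlink : ∀ p : E × X, G.IsLink p p.2 (f p.1 p.2)) (q : O e) :
    (colourClass G (orbitColour r) ⟨e, q⟩).ncard = (r e ⁻¹' {q}).ncard := by
  rw [← Set.ncard_image_of_injective (r e ⁻¹' {q}) (Prod.mk_right_injective e)]
  congr 1
  ext ⟨d, x⟩
  constructor
  · rintro ⟨-, h⟩
    obtain rfl : d = e := congrArg Sigma.fst h
    exact ⟨x, eq_of_heq (Sigma.mk.inj h).2, rfl⟩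
  · rintro ⟨y, rfl, ⟨⟩⟩
    exact ⟨(hlink _).edge_mem, rfl⟩

end OrbitColour

section Odometer

variable {V : Type*} [DecidableEq V] {a b : V} {n : ℕ}

/-- The binary odometer with digits `a < b`, least significant digit first, on the words over `V`;
it stops at the first letter that is not a digit. -/
def odometer (a b : V) : ∀ n : ℕ, (Fin n → V) → (Fin n → V)
  | 0, w => w
  | n + 1, w =>
    if w 0 = a then Fin.cons b (odometer a b n (Fin.tail w))
    else if w 0 = b then Fin.cons a (Fin.tail w) else w

lemma odometer_cons_left (w : Fin n → V) :
    odometer a b (n + 1) (Fin.cons a w : Fin (n + 1) → V) = Fin.cons b (odometer a b n w) := by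
  simp [odometer]

lemma odometer_cons_right (hab : a ≠ b) (w : Fin n → V) :
    odometer a b (n + 1) (Fin.cons b w : Fin (n + 1) → V) = Fin.cons a w := by
  simp [odometer, hab.symm]

lemma odometer_cons_of_ne {z : V} (hza : z ≠ a) (hzb : z ≠ b) (w : Fin n → V) :
    odometer a b (n + 1) (Fin.cons z w : Fin (n + 1) → V) = Fin.cons z w := by
  simp [odometer, hza, hzb]

/-- The orbits of the odometer on words of length `n`: `digit q` consists of the words `a·w` and
`b·w` with `w` in `q`, and `fixed z w` of the single word `z·w`, whose first letter is not a
digit. -/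
inductive OdometerOrbit {V : Type*} (a b : V) : ℕ → Type _
  | nil : OdometerOrbit a b 0
  | digit {n : ℕ} (q : OdometerOrbit a b n) : OdometerOrbit a b (n + 1)
  | fixed {n : ℕ} (z : {z : V // z ≠ a ∧ z ≠ b}) (w : Fin n → V) : OdometerOrbit a b (n + 1)

namespace OdometerOrbit

instance instUnique (a b : V) : Unique (OdometerOrbit a b 0) where
  default := nil
  uniq := fun .nil => rfl

/-- The two kinds of orbits on words of length `n + 1` as a sum type, for products over all
orbits. -/
def succEquiv (a b : V) (n : ℕ) : OdometerOrbit a b (n + 1) ≃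
    OdometerOrbit a b n ⊕ {z : V // z ≠ a ∧ z ≠ b} × (Fin n → V) where
  toFun
    | digit q => .inl q
    | fixed z w => .inr (z, w)
  invFun := Sum.elim digit fun p => fixed p.1 p.2
  left_inv
    | digit _ => rfl
    | fixed _ _ => rfl
  right_inv
    | .inl _ => rfl
    | .inr _ => rfl

instance instFintype [Fintype V] (a b : V) : ∀ n, Fintype (OdometerOrbit a b n)
  | 0 => inferInstance
  | n + 1 =>
    haveI := instFintype a b n
    .ofEquiv _ (succEquiv a b n).symm

end OdometerOrbit

open OdometerOrbit

/-- The orbit of a word under the odometer. -/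
def odometerOrbit (a b : V) : ∀ n : ℕ, (Fin n → V) → OdometerOrbit a b n
  | 0, _ => nil
  | n + 1, w =>
    if hz : w 0 ≠ a ∧ w 0 ≠ b then fixed ⟨w 0, hz⟩ (Fin.tail w)
    else digit (odometerOrbit a b n (Fin.tail w))

lemma odometerOrbit_cons_eq_digit_iff {z : V} {w : Fin n → V} {q : OdometerOrbit a b n} :
    odometerOrbit a b (n + 1) (Fin.cons z w) = digit q ↔
      (z = a ∨ z = b) ∧ odometerOrbit a b n w = q := by
  simp only [odometerOrbit, Fin.cons_zero, Fin.tail_cons]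
  split_ifs with hz
  · exact iff_of_false nofun fun h => not_or.2 hz h.1
  · rw [digit.injEq, and_iff_right (by tauto)]

lemma odometerOrbit_cons_eq_fixed_iff {y : V} {z : {z : V // z ≠ a ∧ z ≠ b}} {v w : Fin n → V} :
    odometerOrbit a b (n + 1) (Fin.cons y v) = fixed z w ↔ y = z ∧ v = w := by
  simp only [odometerOrbit, Fin.cons_zero, Fin.tail_cons]
  split_ifs with hy
  · rw [fixed.injEq, Subtype.ext_iff]
  · exact iff_of_false nofun fun h => hy (h.1 ▸ z.2)

lemma odometer_iterate_two_mul_cons_left (hab : a ≠ b) (w : Fin n → V) (j : ℕ) :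
    (odometer a b (n + 1))^[2 * j] (Fin.cons a w : Fin (n + 1) → V) =
      Fin.cons a ((odometer a b n)^[j] w) := by
  rw [Function.iterate_mul]
  refine (Function.Semiconj.iterate_right (f := fun w => (Fin.cons a w : Fin (n + 1) → V))
    (fun w => ?_) j w).symm
  rw [Function.iterate_succ_apply, Function.iterate_one, odometer_cons_left,
    odometer_cons_right hab]

lemma odometerOrbit_odometer (hab : a ≠ b) (w : Fin n → V) :
    odometerOrbit a b n (odometer a b n w) = odometerOrbit a b n w := by
  induction n with
  | zero => rfl
  | succ n ih =>
    induction w using Fin.consCases with | _ z w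
    by_cases hza : z = a
    · subst hza
      rw [odometer_cons_left, odometerOrbit_cons_eq_digit_iff.2 ⟨.inr rfl, ih w⟩,
        odometerOrbit_cons_eq_digit_iff.2 ⟨.inl rfl, rfl⟩]
    by_cases hzb : z = b
    · subst hzb
      rw [odometer_cons_right hab, odometerOrbit_cons_eq_digit_iff.2 ⟨.inl rfl, rfl⟩,
        odometerOrbit_cons_eq_digit_iff.2 ⟨.inr rfl, rfl⟩]
    · rw [odometer_cons_of_ne hza hzb]

lemma odometerOrbit_surjective (a b : V) (n : ℕ) :
    Function.Surjective (odometerOrbit a b n) := by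
  intro q
  induction q with
  | nil => exact ⟨Fin.elim0, rfl⟩
  | digit q ih =>
    obtain ⟨w, hw⟩ := ih
    exact ⟨Fin.cons a w, odometerOrbit_cons_eq_digit_iff.2 ⟨.inl rfl, hw⟩⟩
  | fixed z w => exact ⟨Fin.cons z w, odometerOrbit_cons_eq_fixed_iff.2 ⟨rfl, rfl⟩⟩

lemma exists_odometer_iterate_eq (hab : a ≠ b) {v w : Fin n → V}
    (h : odometerOrbit a b n v = odometerOrbit a b n w) : ∃ j, (odometer a b n)^[j] v = w := by
  induction n with
  | zero => exact ⟨0, Subsingleton.elim _ _⟩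
  | succ n ih =>
    have hleft : ∀ (v : Fin n → V) (z : V) (w : Fin n → V), z = a ∨ z = b →
        odometerOrbit a b n v = odometerOrbit a b n w →
        ∃ j, (odometer a b (n + 1))^[j] (Fin.cons a v : Fin (n + 1) → V) = Fin.cons z w := by
      rintro v z w (rfl | rfl) hvw
      · obtain ⟨j, rfl⟩ := ih hvw
        exact ⟨2 * j, odometer_iterate_two_mul_cons_left hab v j⟩
      · obtain ⟨j, hj⟩ := ih ((odometerOrbit_odometer hab v).trans hvw)
        refine ⟨2 * j + 1, ?_⟩
        rw [Function.iterate_succ_apply', odometer_iterate_two_mul_cons_left hab,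
          odometer_cons_left, ← hj, ← Function.iterate_succ_apply, Function.iterate_succ_apply']
    induction v using Fin.consCases with | _ y v
    induction w using Fin.consCases with | _ z w
    cases hq : odometerOrbit a b (n + 1) (Fin.cons y v) with
    | fixed x u =>
      obtain ⟨rfl, rfl⟩ := odometerOrbit_cons_eq_fixed_iff.1 hq
      obtain ⟨rfl, rfl⟩ := odometerOrbit_cons_eq_fixed_iff.1 (h.symm.trans hq)
      exact ⟨0, rfl⟩
    | digit q =>
      obtain ⟨hy, hv⟩ := odometerOrbit_cons_eq_digit_iff.1 hq
      obtain ⟨hz, hw⟩ := odometerOrbit_cons_eq_digit_iff.1 (h.symm.trans hq)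
      rcases hy with rfl | rfl
      · exact hleft v z w hz (hv.trans hw.symm)
      · obtain ⟨j, hj⟩ := hleft v z w hz (hv.trans hw.symm)
        exact ⟨j + 1, by rw [Function.iterate_succ_apply, odometer_cons_right hab, hj]⟩

theorem isOrbitMap_odometer (hab : a ≠ b) (n : ℕ) :
    IsOrbitMap (odometer a b n) (odometerOrbit a b n) where
  surjective := odometerOrbit_surjective a b n
  apply_eq := odometerOrbit_odometer hab
  exists_iterate_eq := exists_odometer_iterate_eq hab

lemma ncard_odometerOrbit_preimage_digit (hab : a ≠ b) (q : OdometerOrbit a b n) :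
    (odometerOrbit a b (n + 1) ⁻¹' {digit q}).ncard = 2 * (odometerOrbit a b n ⁻¹' {q}).ncard := by
  have himage : odometerOrbit a b (n + 1) ⁻¹' {digit q} =
      Fin.consEquiv (fun _ => V) '' ({a, b} ×ˢ (odometerOrbit a b n ⁻¹' {q})) := by
    ext u
    induction u using Fin.consCases with | _ z w
    rw [Set.mem_preimage, Set.mem_singleton_iff, odometerOrbit_cons_eq_digit_iff]
    exact ((Fin.consEquiv fun _ => V).injective.mem_set_image (a := (z, w))
      (s := {a, b} ×ˢ (odometerOrbit a b n ⁻¹' {q}))).symm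
  rw [himage, Set.ncard_image_of_injective _ (Equiv.injective _), Set.ncard_prod,
    Set.ncard_pair hab]

lemma ncard_odometerOrbit_preimage_fixed (z : {z : V // z ≠ a ∧ z ≠ b}) (w : Fin n → V) :
    (odometerOrbit a b (n + 1) ⁻¹' {fixed z w}).ncard = 1 := by
  rw [Set.ncard_eq_one]
  refine ⟨Fin.cons z w, Set.ext fun u => ?_⟩
  induction u using Fin.consCases with | _ y v
  rw [Set.mem_preimage, Set.mem_singleton_iff, odometerOrbit_cons_eq_fixed_iff,
    Set.mem_singleton_iff, Fin.cons_inj]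

lemma card_ne_and_ne [Fintype V] (hab : a ≠ b) :
    Fintype.card {z : V // z ≠ a ∧ z ≠ b} = Fintype.card V - 2 := by
  rw [← Finset.card_pair hab, ← Finset.card_compl, Fintype.card_subtype]
  congr 1
  ext z
  simp

theorem prod_ncard_odometerOrbit_preimage [Fintype V] {M : Type*} [CommMonoid M] (hab : a ≠ b)
    (n : ℕ) (ψ : ℕ → M) :
    ∏ q, ψ (odometerOrbit a b n ⁻¹' {q}).ncard = ψ (2 ^ n) * ∏ i ∈ Finset.range n,
      ψ (2 ^ i) ^ ((Fintype.card V - 2) * Fintype.card V ^ (n - i - 1)) := by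
  induction n generalizing ψ with
  | zero =>
    have hsingle : odometerOrbit a b 0 ⁻¹' {default} = {Fin.elim0} :=
      Set.ext fun w => iff_of_true rfl (Subsingleton.elim _ _)
    rw [Fintype.prod_unique, hsingle, Set.ncard_singleton, pow_zero, Finset.prod_range_zero,
      mul_one]
  | succ n ih =>
    have hdigit : ∏ q, ψ (odometerOrbit a b (n + 1) ⁻¹' {digit q}).ncard =
        ψ (2 ^ (n + 1)) * ∏ i ∈ Finset.range n,
          ψ (2 ^ (i + 1)) ^ ((Fintype.card V - 2) * Fintype.card V ^ (n - i - 1)) := by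
      simp only [ncard_odometerOrbit_preimage_digit hab, pow_succ']
      exact ih fun m => ψ (2 * m)
    have hfixed : ∏ p : {z : V // z ≠ a ∧ z ≠ b} × (Fin n → V),
        ψ (odometerOrbit a b (n + 1) ⁻¹' {fixed p.1 p.2}).ncard =
          ψ 1 ^ ((Fintype.card V - 2) * Fintype.card V ^ n) := by
      simp only [ncard_odometerOrbit_preimage_fixed, Finset.prod_const, Finset.card_univ,
        Fintype.card_prod, card_ne_and_ne hab, Fintype.card_fun, Fintype.card_fin]
    rw [← (succEquiv a b n).symm.prod_comp, Fintype.prod_sum_type]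
    refine (congrArg₂ _ hdigit hfixed).trans ?_
    rw [Finset.prod_range_succ', mul_assoc]
    simp only [Nat.reduceSubDiff, Nat.sub_zero, Nat.add_sub_cancel, pow_zero]

end Odometer

section Retraction

variable {V : Type*} {z₀ : V} {n : ℕ} {π : V → V} {O : Set (Fin n → V)}
  {φ : (Fin n → V) → (Fin n → V)}

/-- The first letter of a word, with the default value `z₀` for the empty word. -/
def firstLetter {V : Type*} (z₀ : V) : ∀ n : ℕ, (Fin n → V) → V
  | 0, _ => z₀
  | _ + 1, w => w 0

open Classical in
/-- The lift to words of length `n + 1` of a retraction `φ` onto a set `O` of words of length `n`,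
by the map `π` on first letters. Over a word outside of `O`, all letters are first merged into the
first letter of its image under `φ`, so that the lift is not affected by the edges that `φ`
contracts between `O` and its complement. -/
noncomputable def liftRetraction {V : Type*} {n : ℕ} (π : V → V) (z₀ : V) (O : Set (Fin n → V))
    (φ : (Fin n → V) → (Fin n → V)) (u : Fin (n + 1) → V) : Fin (n + 1) → V :=
  Fin.cons (π (if Fin.tail u ∈ O then u 0 else firstLetter z₀ n (φ (Fin.tail u))))
    (φ (Fin.tail u))

lemma liftRetraction_cons_of_mem (z : V) {w : Fin n → V} (hw : w ∈ O) :
    liftRetraction π z₀ O φ (Fin.cons z w) = Fin.cons (π z) (φ w) := by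
  rw [liftRetraction, Fin.tail_cons, if_pos hw, Fin.cons_zero]

lemma liftRetraction_cons_of_notMem (z : V) {w : Fin n → V} (hw : w ∉ O) :
    liftRetraction π z₀ O φ (Fin.cons z w) = Fin.cons (π (firstLetter z₀ n (φ w))) (φ w) := by
  rw [liftRetraction, Fin.tail_cons, if_neg hw]

lemma liftRetraction_cons_congr {y z : V} (hπ : π y = π z) (w : Fin n → V) :
    liftRetraction π z₀ O φ (Fin.cons y w) = liftRetraction π z₀ O φ (Fin.cons z w) := by
  by_cases hw : w ∈ O
  · rw [liftRetraction_cons_of_mem y hw, liftRetraction_cons_of_mem z hw, hπ]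
  · rw [liftRetraction_cons_of_notMem y hw, liftRetraction_cons_of_notMem z hw]

variable [DecidableEq V] {a b : V}

lemma firstLetter_eq_or_eq_of_odometer_ne {w : Fin n → V} (hw : odometer a b n w ≠ w) :
    firstLetter z₀ n w = a ∨ firstLetter z₀ n w = b := by
  cases n with
  | zero => exact (hw (Subsingleton.elim _ _)).elim
  | succ n =>
    by_contra! hne
    exact hw ((if_neg hne.1).trans (if_neg hne.2))

lemma liftRetraction_cons_odometer (hab : a ≠ b) (hπ : π a = π b) (hO : ∀ w ∈ O, φ w = w)
    (hφ : ∀ w, φ (odometer a b n w) = φ w) (w : Fin n → V) :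
    liftRetraction π z₀ O φ (Fin.cons b (odometer a b n w)) =
      liftRetraction π z₀ O φ (Fin.cons a w) := by
  by_cases hfix : odometer a b n w = w
  · rw [hfix]
    exact liftRetraction_cons_congr hπ.symm w
  have hfix' : odometer a b n (odometer a b n w) ≠ odometer a b n w :=
    (isOrbitMap_odometer hab n).injective.ne hfix
  have hfirst : ∀ v, odometer a b n v ≠ v → π (firstLetter z₀ n v) = π a := by
    intro v hv
    rcases firstLetter_eq_or_eq_of_odometer_ne (z₀ := z₀) hv with h | h
    exacts [congrArg π h, (congrArg π h).trans hπ.symm]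
  by_cases hodo : odometer a b n w ∈ O <;> by_cases hw : w ∈ O
  · rw [liftRetraction_cons_of_mem b hodo, liftRetraction_cons_of_mem a hw, hφ, hπ]
  · rw [liftRetraction_cons_of_mem b hodo, liftRetraction_cons_of_notMem a hw, ← hφ w,
      hO _ hodo, hfirst _ hfix', hπ]
  · rw [liftRetraction_cons_of_notMem b hodo, liftRetraction_cons_of_mem a hw, hφ, hO w hw,
      hfirst w hfix]
  · rw [liftRetraction_cons_of_notMem b hodo, liftRetraction_cons_of_notMem a hw, hφ]

lemma liftRetraction_odometer (hab : a ≠ b) (hπ : π a = π b) (hO : ∀ w ∈ O, φ w = w)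
    (hφ : ∀ w, φ (odometer a b n w) = φ w) (u : Fin (n + 1) → V) :
    liftRetraction π z₀ O φ (odometer a b (n + 1) u) = liftRetraction π z₀ O φ u := by
  induction u using Fin.consCases with | _ z w
  by_cases hza : z = a
  · rw [hza, odometer_cons_left]
    exact liftRetraction_cons_odometer hab hπ hO hφ w
  by_cases hzb : z = b
  · rw [hzb, odometer_cons_right hab]
    exact liftRetraction_cons_congr hπ w
  · rw [odometer_cons_of_ne hza hzb]

lemma liftRetraction_odometer_of_notMem (hab : a ≠ b) {q : OdometerOrbit a b n}
    (hφ : ∀ w, odometerOrbit a b n w ≠ q → φ (odometer a b n w) = φ w) {u : Fin (n + 1) → V}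
    (hu : odometerOrbit a b (n + 1) u ≠ .digit q) :
    liftRetraction π z₀ (odometerOrbit a b n ⁻¹' {q}) φ (odometer a b (n + 1) u) =
      liftRetraction π z₀ (odometerOrbit a b n ⁻¹' {q}) φ u := by
  induction u using Fin.consCases with | _ z w
  rw [Ne, odometerOrbit_cons_eq_digit_iff, not_and] at hu
  by_cases hza : z = a
  · have hw : w ∉ odometerOrbit a b n ⁻¹' {q} := hu (.inl hza)
    have hodo : odometer a b n w ∉ odometerOrbit a b n ⁻¹' {q} := by
      rwa [Set.mem_preimage, odometerOrbit_odometer hab]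
    rw [hza, odometer_cons_left, liftRetraction_cons_of_notMem b hodo,
      liftRetraction_cons_of_notMem a hw, hφ w hw]
  by_cases hzb : z = b
  · have hw : w ∉ odometerOrbit a b n ⁻¹' {q} := hu (.inr hzb)
    rw [hzb, odometer_cons_right hab, liftRetraction_cons_of_notMem a hw,
      liftRetraction_cons_of_notMem b hw]
  · rw [odometer_cons_of_ne hza hzb]

theorem exists_isOrbitRetraction_odometer {E : Type*} {arc : E → V × V} {e : E}
    (hne : ∀ d, (arc d).1 ≠ (arc d).2) (hfst : π (arc e).1 = (arc e).1)
    (hsnd : π (arc e).2 = (arc e).2) (hπ : ∀ d ≠ e, π (arc d).1 = π (arc d).2)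
    (q : OdometerOrbit (arc e).1 (arc e).2 n) :
    ∃ φ, IsOrbitRetraction (fun d => odometer (arc d).1 (arc d).2 n)
      (fun d => odometerOrbit (arc d).1 (arc d).2 n) e q φ := by
  induction q with
  | nil => exact ⟨id, fun _ _ => rfl, fun _ _ _ => rfl, fun _ _ => rfl⟩
  | fixed z w =>
    refine ⟨fun _ => Fin.cons z w, fun u hu => ?_, fun _ _ _ => rfl, fun _ _ => rfl⟩
    induction u using Fin.consCases with | _ y v
    obtain ⟨rfl, rfl⟩ := odometerOrbit_cons_eq_fixed_iff.1 hu
    rfl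
  | @digit n q ih =>
    obtain ⟨φ, hφ⟩ := ih
    refine ⟨liftRetraction π (arc e).1 (odometerOrbit _ _ n ⁻¹' {q}) φ, fun u hu => ?_,
      fun d hd => liftRetraction_odometer (hne d) (hπ d hd) hφ.apply_of_mem
        (hφ.apply_eq_of_ne d hd),
      fun u => liftRetraction_odometer_of_notMem (hne e) hφ.apply_eq_of_notMem⟩
    induction u using Fin.consCases with | _ z w
    obtain ⟨hz, hw⟩ := odometerOrbit_cons_eq_digit_iff.1 hu
    have hπz : π z = z := by rcases hz with rfl | rfl <;> assumption
    rw [liftRetraction_cons_of_mem z hw, hφ.apply_of_mem w hw, hπz]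

end Retraction

section Automaton

variable {V : Type*} {G : SimpleGraph V}

lemma adj_arc (o : G.EdgeOrientation) (e : G.edgeSet) : G.Adj (o.arc e).1 (o.arc e).2 := by
  rw [← SimpleGraph.mem_edgeSet, o.mk_arc e]
  exact e.2

lemma exists_forall_ne_map_arc_eq (hG : G.IsAcyclic) (o : G.EdgeOrientation) (e : G.edgeSet) :
    ∃ π : V → V, π (o.arc e).1 = (o.arc e).1 ∧ π (o.arc e).2 = (o.arc e).2 ∧
      ∀ d ≠ e, π (o.arc d).1 = π (o.arc d).2 := by
  classical
  let H := G.deleteEdges {(e : Sym2 V)}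
  have hsep : ¬ H.Reachable (o.arc e).1 (o.arc e).2 := by
    have hbridge := SimpleGraph.isAcyclic_iff_forall_isBridge.1 hG e.2
    rwa [← o.mk_arc e, SimpleGraph.isBridge_iff, o.mk_arc e] at hbridge
  refine ⟨fun v => if H.Reachable (o.arc e).1 v then (o.arc e).1 else (o.arc e).2,
    if_pos (.refl _), if_neg hsep, fun d hd => ?_⟩
  have hadj : H.Adj (o.arc d).1 (o.arc d).2 := by
    rw [SimpleGraph.deleteEdges_adj, o.mk_arc d]
    exact ⟨adj_arc o d, fun h => hd (Subtype.ext h)⟩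
  have hside : H.Reachable (o.arc e).1 (o.arc d).1 ↔ H.Reachable (o.arc e).1 (o.arc d).2 :=
    ⟨fun h => h.trans hadj.reachable, fun h => h.trans hadj.symm.reachable⟩
  simp only [hside]

variable [DecidableEq V]

lemma act_graphAutomaton_none (o : G.EdgeOrientation) (n : ℕ) (w : Fin n → V) :
    (SimpleGraph.graphAutomaton o).act n none w = w := by
  induction n with
  | zero => rfl
  | succ n ih =>
    change Fin.cons (w 0) ((SimpleGraph.graphAutomaton o).act n none (Fin.tail w)) = w
    rw [ih, Fin.cons_self_tail]

lemma act_graphAutomaton_some (o : G.EdgeOrientation) (e : G.edgeSet) (n : ℕ) :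
    (SimpleGraph.graphAutomaton o).act n (some e) = odometer (o.arc e).1 (o.arc e).2 n := by
  induction n with
  | zero => rfl
  | succ n ih =>
    funext w
    simp only [Transducer.act, SimpleGraph.graphAutomaton, odometer]
    split_ifs
    · exact congrArg (Fin.cons _) (congrFun ih _)
    · exact congrArg (Fin.cons _) (act_graphAutomaton_none o n _)
    · exact (congrArg (Fin.cons _) (act_graphAutomaton_none o n _)).trans (Fin.cons_self_tail w)

lemma automatonSchreierGraph_isLink (o : G.EdgeOrientation) (n : ℕ)
    (p : G.edgeSet × (Fin n → V)) : (SimpleGraph.automatonSchreierGraph o n).IsLink p p.2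
      (odometer (o.arc p.1).1 (o.arc p.1).2 n p.2) := by
  rw [← act_graphAutomaton_some]
  exact rfl

/-- The colouring of the edges of the Schreier graph by the orbits of the automaton states. -/
def automatonColour (o : G.EdgeOrientation) (n : ℕ) : G.edgeSet × (Fin n → V) →
    Σ e : G.edgeSet, OdometerOrbit (o.arc e).1 (o.arc e).2 n :=
  orbitColour fun e => odometerOrbit (o.arc e).1 (o.arc e).2 n

theorem isCircuitSum_automatonColour (hG : G.IsAcyclic) (o : G.EdgeOrientation) (n : ℕ) :
    IsCircuitSum (SimpleGraph.automatonSchreierGraph o n) (automatonColour o n) Set.univ := by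
  refine isCircuitSum_orbitColour (fun e => isOrbitMap_odometer (adj_arc o e).ne n)
    (automatonSchreierGraph_isLink o n) fun e q => ?_
  obtain ⟨π, hfst, hsnd, hπ⟩ := exists_forall_ne_map_arc_eq hG o e
  exact exists_isOrbitRetraction_odometer (fun d => (adj_arc o d).ne) hfst hsnd hπ q

lemma ncard_colourClass_automatonColour (o : G.EdgeOrientation) (n : ℕ) (e : G.edgeSet)
    (q : OdometerOrbit (o.arc e).1 (o.arc e).2 n) :
    (colourClass (SimpleGraph.automatonSchreierGraph o n) (automatonColour o n) ⟨e, q⟩).ncard =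
      (odometerOrbit (o.arc e).1 (o.arc e).2 n ⁻¹' {q}).ncard :=
  ncard_colourClass_orbitColour (r := fun e => odometerOrbit (o.arc e).1 (o.arc e).2 n)
    (f := fun e => odometer (o.arc e).1 (o.arc e).2 n) (automatonSchreierGraph_isLink o n) q

lemma circuitSumPolynomial_automatonColour [Fintype V] [Fintype G.edgeSet]
    (o : G.EdgeOrientation) (n : ℕ) :
    circuitSumPolynomial (SimpleGraph.automatonSchreierGraph o n) (automatonColour o n) Set.univ =
      (cyclePolynomial (2 ^ n) * ∏ i ∈ Finset.range n, cyclePolynomial (2 ^ i) ^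
        ((Fintype.card V - 2) * Fintype.card V ^ (n - i - 1))) ^ Fintype.card G.edgeSet := by
  have horbits : ∀ e : G.edgeSet, ∏ q, classPolynomial Set.univ
      (⟨e, q⟩ : Σ e : G.edgeSet, OdometerOrbit (o.arc e).1 (o.arc e).2 n)
      (colourClass (SimpleGraph.automatonSchreierGraph o n) (automatonColour o n) ⟨e, q⟩).ncard =
      cyclePolynomial (2 ^ n) * ∏ i ∈ Finset.range n, cyclePolynomial (2 ^ i) ^
        ((Fintype.card V - 2) * Fintype.card V ^ (n - i - 1)) := by
    intro e
    simp only [classPolynomial, Set.mem_univ, if_true, ncard_colourClass_automatonColour]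
    exact prod_ncard_odometerOrbit_preimage (adj_arc o e).ne n cyclePolynomial
  rw [circuitSumPolynomial, Fintype.prod_sigma, Fintype.prod_congr _ _ horbits, Finset.prod_const,
    Finset.card_univ]

end Automaton

end TreeAutomaton

theorem mainTheorem3_general {V : Type*} [Fintype V] [DecidableEq V] (G : SimpleGraph V)
    (hG : G.IsAcyclic) (o : G.EdgeOrientation) (k m : ℕ) (hk : Fintype.card V = k)
    (hm : Nat.card G.edgeSet = m) (n : ℕ) (hn : 1 ≤ n) (p : MvPolynomial (Fin 2) ℤ) :
    (SimpleGraph.automatonSchreierGraph o n).IsTuttePolynomial p ↔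
      p = MvPolynomial.X 1 ^ (m * (k - 2) * k ^ (n - 1)) * cyclePolynomial (2 ^ n) ^ m *
        ∏ i ∈ Finset.Ico 1 n, cyclePolynomial (2 ^ i) ^ (m * (k - 2) * k ^ (n - i - 1)) := by
  have := Fintype.ofFinite G.edgeSet
  rw [Nat.card_eq_fintype_card] at hm
  rw [(TreeAutomaton.isCircuitSum_automatonColour hG o n).isTuttePolynomial_iff (Set.toFinite _),
    TreeAutomaton.circuitSumPolynomial_automatonColour, hk, hm]
  have hloops : cyclePolynomial (2 ^ 0) = MvPolynomial.X 1 := TreeAutomaton.cyclePolynomial_one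
  rw [Finset.range_eq_Ico, Finset.prod_eq_prod_Ico_succ_bot hn, hloops, mul_pow, mul_pow,
    ← Finset.prod_pow, ← mul_assoc, mul_comm (cyclePolynomial (2 ^ n) ^ m)]
  simp only [← pow_mul, Nat.sub_zero, zero_add, mul_comm _ m, mul_assoc]

theorem mainTheorem3 {V : Type*} [Fintype V] [DecidableEq V] (G : SimpleGraph V)
    (hG : G.IsTree) (o : G.EdgeOrientation) (k : ℕ) (hk : Fintype.card V = k) (hk2 : 2 ≤ k)
    (n : ℕ) (hn : 1 ≤ n) (p : MvPolynomial (Fin 2) ℤ) :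
    (SimpleGraph.automatonSchreierGraph o n).IsTuttePolynomial p ↔
      p = MvPolynomial.X 1 ^ ((k - 1) * (k - 2) * k ^ (n - 1)) *
          cyclePolynomial (2 ^ n) ^ (k - 1) *
          ∏ i ∈ Finset.Ico 1 n,
            cyclePolynomial (2 ^ i) ^ ((k - 1) * (k - 2) * k ^ (n - i - 1)) := by
  have hcard := (SimpleGraph.isTree_iff_connected_and_card.1 hG).2
  exact mainTheorem3_general G hG.isAcyclic o k (k - 1) hk
    (by rw [← hk, ← Nat.card_eq_fintype_card, ← hcard, Nat.add_sub_cancel]) n hn p
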